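/- **Theorem 5.1.** Let $\mathcal H$ be a complex Hilbert space and let $\mathcal B(\mathcal H)$ be the algebra of everywhere defined bounded linear operators on $\mathcal H$, with the operator norm. For $A\in\mathcal B(\mathcal H)$ and $g\in\mathcal H$ let $\mathcal K(A,g)=\operatorname{span}\{A^kg : k=0,1,2,\dots\}$. A *Krylov solution* of $Af=g$ is an $f\in\overline{\mathcal K(A,g)}$ (norm closure) with $Af=g$, and the problem $Af=g$ is *Krylov solvable* if it has a Krylov solution. The operator $A$ is *of $\mathcal K$-class* if there is an open set $\mathcal W\subset\mathbb C$ such that $\sigma(A)\subset\mathcal W$, $\overline{\mathcal W}$ is compact, $0\notin\overline{\mathcal W}$ and $\mathbb C\setminus\overline{\mathcal W}$ is connected. Let $A\in\mathcal B(\mathcal H)$ be of $\mathcal K$-class. Then: (i) $A$ is invertible in $\mathcal B(\mathcal H)$; there is a sequence of complex polynomials $(p_n)$ with $\|p_n(A)-A^{-1}\|\to0$; and for every $g\in\mathcal H$ the problem $Af=g$ is Krylov solvable, with unique solution $f=A^{-1}g$. (ii) The set of operators of $\mathcal K$-class is open in $\mathcal B(\mathcal H)$. In particular, there is $\varepsilon_A>0$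 such that every $A'\in\mathcal B(\mathcal H)$ with $\|A'-A\|<\varepsilon_A$ is of $\mathcal K$-class and invertible, and for every $g\in\mathcal H$ the problem $A'f'=g$ is Krylov solvable, with unique solution $f'=A'^{-1}g$. (iii) If $A'\in\mathcal B(\mathcal H)$ satisfies $\|A-A'\|\le(2\|A^{-1}\|)^{-1}$, then $A'$ is invertible, and for every $g\in\mathcal H$ the solutions $f$ of $Af=g$ and $f'$ of $A'f'=g$ satisfy $$\|f-f'\|\le 2\,\|g\|\,\|A^{-1}\|^2\,\|A'-A\|.$$ -/

import Mathlib

/-- The Krylov subspace `span {g, A g, A² g, …}` (finite linear combinations). -/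
def krylovSubspace {H : Type*} [NormedAddCommGroup H] [InnerProductSpace ℂ H]
    (A : H →L[ℂ] H) (g : H) : Submodule ℂ H :=
  Submodule.span ℂ (Set.range fun k : ℕ => (A ^ k) g)

/-- A Krylov solution of `A f = g`: a solution lying in the norm closure of the Krylov subspace. -/
def IsKrylovSolution {H : Type*} [NormedAddCommGroup H] [InnerProductSpace ℂ H]
    (A : H →L[ℂ] H) (g f : H) : Prop :=
  A f = g ∧ f ∈ closure (krylovSubspace A g : Set H)

/-- The inverse problem `A f = g` is Krylov solvable when it has a Krylov solution. -/
def KrylovSolvable {H : Type*} [NormedAddCommGroup H] [InnerProductSpace ℂ H]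
    (A : H →L[ℂ] H) (g : H) : Prop :=
  ∃ f : H, IsKrylovSolution A g f

/-- The `𝒦`-class of bounded operators on a complex Hilbert space. -/
def IsKClass {H : Type*} [NormedAddCommGroup H] [InnerProductSpace ℂ H]
    (A : H →L[ℂ] H) : Prop :=
  ∃ W : Set ℂ, IsOpen W ∧ spectrum ℂ A ⊆ W ∧ IsCompact (closure W) ∧
    (0 : ℂ) ∉ closure W ∧ IsConnected (closure W)ᶜ

/-- The other common form of the definition, asking that `ℂ \ W` (rather than the complement of
the closure of `W`) be connected, describes the same class. -/
theorem isKClass_iff {H : Type*} [NormedAddCommGroup H] [InnerProductSpace ℂ H]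
    [CompleteSpace H] (A : H →L[ℂ] H) :
    IsKClass A ↔ ∃ W : Set ℂ, IsOpen W ∧ spectrum ℂ A ⊆ W ∧ Bornology.IsBounded W ∧
      (0 : ℂ) ∉ closure W ∧ IsConnected Wᶜ := by
  constructor
  · rintro ⟨W, hWo, hsp, hc, h0, hcon⟩
    have hcl : closure (interior (closure W)) ⊆ closure W :=
      closure_minimal interior_subset isClosed_closure
    refine ⟨interior (closure W), isOpen_interior, hsp.trans (interior_maximal subset_closure hWo),
      hc.isBounded.subset interior_subset, fun h => h0 (hcl h), ?_⟩
    rw [← closure_compl]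
    exact hcon.closure
  · rintro ⟨W, hWo, hsp, hb, h0, hcon⟩
    have hdisj : Disjoint Wᶜ (spectrum ℂ A) :=
      Set.disjoint_left.2 fun x hx hx' => hx (hsp hx')
    obtain ⟨δ, hδ, hd⟩ := hdisj.symm.exists_cthickenings (spectrum.isCompact A) hWo.isClosed_compl
    set T : Set ℂ := Metric.thickening δ Wᶜ with hT
    have hFT : Wᶜ ⊆ T := Metric.self_subset_thickening hδ _
    have hTo : IsOpen T := Metric.isOpen_thickening
    have hTc : IsConnected T := by
      obtain ⟨x₀, hx₀⟩ := hcon.nonempty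
      refine ⟨⟨x₀, hFT hx₀⟩, isPreconnected_of_forall x₀ fun y hy => ?_⟩
      obtain ⟨z, hz, hyz⟩ := Metric.mem_thickening_iff.1 hy
      refine ⟨Wᶜ ∪ Metric.ball z δ, Set.union_subset hFT fun w hw =>
        Metric.mem_thickening_iff.2 ⟨z, hz, hw⟩, Or.inl hx₀, Or.inr hyz, ?_⟩
      exact IsPreconnected.union z hz (Metric.mem_ball_self hδ) hcon.isPreconnected
        (convex_ball z δ).isPreconnected
    have hcl : closure (closure T)ᶜ ⊆ Tᶜ :=
      closure_minimal (Set.compl_subset_compl.2 subset_closure) hTo.isClosed_compl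
    have hTW : Tᶜ ⊆ W := by
      intro x hx
      by_contra h
      exact hx (hFT h)
    refine ⟨(closure T)ᶜ, isClosed_closure.isOpen_compl, ?_, ?_, ?_, ?_⟩
    · intro x hx hxT
      exact Set.disjoint_left.1 hd (Metric.self_subset_cthickening _ hx)
        (Metric.closure_thickening_subset_cthickening _ _ hxT)
    · exact Metric.isCompact_of_isClosed_isBounded isClosed_closure (hb.subset (hcl.trans hTW))
    · exact fun h => h0 (subset_closure (hTW (hcl h)))
    · refine hTc.subset_closure (Set.subset_compl_comm.1 hcl) ?_
      rw [closure_compl, compl_compl]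
      exact interior_subset

open Filter Topology

/-! Passing to the closed subalgebra generated by `A` enlarges the spectrum only by filling bounded
components of the resolvent set. For `A` of K-class, `0` lies in an unbounded one, so `A` is already
invertible in that subalgebra, where polynomials in `A` are dense
(`isUnit_and_inverse_mem_elemental`, `exists_tendsto_aeval_of_mem_elemental`). Applying these
polynomials to `g` gives Krylov vectors tending to the solution. Openness is upper hemicontinuity of
the spectrum; stability is a resolvent-type identity. -/

/-- If `0` lies in an unbounded connected set disjoint from the spectrum of `a`, then `a` is
invertible and its inverse lies in the closed subalgebra generated by `a`. -/
theorem isUnit_and_inverse_mem_elemental {R : Type*} [NormedRing R] [NormedAlgebra ℂ R]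
    [CompleteSpace R] (a : R) {U : Set ℂ} (hU : IsPreconnected U) (h0 : (0 : ℂ) ∈ U)
    (hunb : ¬ Bornology.IsBounded U) (hdisj : U ⊆ (spectrum ℂ a)ᶜ) :
    IsUnit a ∧ Ring.inverse a ∈ Algebra.elemental ℂ a := by
  set x : Algebra.elemental ℂ a := ⟨a, Algebra.elemental.self_mem ℂ a⟩ with hx
  have hcl : IsClosed ((Algebra.elemental ℂ a : Subalgebra ℂ R) : Set R) :=
    Algebra.elemental.isClosed ℂ a
  have hux : IsUnit x := by
    by_contra hnu
    have hz : (0 : ℂ) ∈ spectrum ℂ x := spectrum.zero_mem ℂ hnu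
    refine hunb ((Subalgebra.spectrum_isBounded_connectedComponentIn
      (Algebra.elemental ℂ a) x hz).subset ?_)
    exact hU.subset_connectedComponentIn h0 hdisj
  have hmap := Ring.inverse_unit (hux.unit.map (Algebra.elemental ℂ a).val.toMonoidHom)
  refine ⟨hux.map (Algebra.elemental ℂ a).val, ?_⟩
  have : Ring.inverse a = ((hux.unit⁻¹ : (Algebra.elemental ℂ a)ˣ) : Algebra.elemental ℂ a) := hmap
  rw [this]
  exact Subtype.property _

/-- Elements of the closed subalgebra generated by `a` are limits of polynomials in `a`. -/
theorem exists_tendsto_aeval_of_mem_elemental {R : Type*} [NormedRing R] [NormedAlgebra ℂ R]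
    {a b : R} (hb : b ∈ Algebra.elemental ℂ a) :
    ∃ p : ℕ → Polynomial ℂ, Tendsto (fun n => Polynomial.aeval a (p n)) atTop (𝓝 b) := by
  have hb' : b ∈ closure ((Algebra.adjoin ℂ {a} : Subalgebra ℂ R) : Set R) := hb
  obtain ⟨u, hu, hlim⟩ := mem_closure_iff_seq_limit.1 hb'
  have h : ∀ n, ∃ q : Polynomial ℂ, Polynomial.aeval a q = u n := fun n => by
    have := hu n
    rwa [Algebra.adjoin_singleton_eq_range_aeval] at this
  choose p hp using h
  exact ⟨p, by simpa only [hp] using hlim⟩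

section Operators

variable {H : Type*} [NormedAddCommGroup H] [InnerProductSpace ℂ H]

theorem aeval_apply_mem_krylovSubspace (A : H →L[ℂ] H) (g : H) (p : Polynomial ℂ) :
    Polynomial.aeval A p g ∈ krylovSubspace A g := by
  rw [Polynomial.aeval_eq_sum_range, sum_apply]
  exact Submodule.sum_mem _ fun k _ =>
    Submodule.smul_mem _ _ (Submodule.subset_span (Set.mem_range_self k))

theorem apply_eq_iff_eq_inverse_apply {A : H →L[ℂ] H} (hA : IsUnit A) (f g : H) :
    A f = g ↔ f = Ring.inverse A g := by
  have h1 := Ring.inverse_mul_cancel A hA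
  have h2 := Ring.mul_inverse_cancel A hA
  constructor
  · rintro rfl
    exact (congrArg (fun T : H →L[ℂ] H => T f) h1).symm
  · rintro rfl
    exact congrArg (fun T : H →L[ℂ] H => T g) h2

theorem krylovSolvable_of_tendsto_aeval {A : H →L[ℂ] H} (hA : IsUnit A) {p : ℕ → Polynomial ℂ}
    (hp : Tendsto (fun n => Polynomial.aeval A (p n)) atTop (𝓝 (Ring.inverse A))) (g : H) :
    KrylovSolvable A g := by
  refine ⟨Ring.inverse A g, (apply_eq_iff_eq_inverse_apply hA _ _).2 rfl, ?_⟩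
  have hlim : Tendsto (fun n => Polynomial.aeval A (p n) g) atTop (𝓝 (Ring.inverse A g)) :=
    ((ContinuousLinearMap.apply ℂ H g).continuous.tendsto _).comp hp
  exact mem_closure_of_tendsto hlim
    (Eventually.of_forall fun n => aeval_apply_mem_krylovSubspace A g (p n))

theorem norm_sub_le_of_norm_sub_le_inv_two_mul {A A' : H →L[ℂ] H} (hA : IsUnit A)
    (h : ‖A - A'‖ ≤ (2 * ‖Ring.inverse A‖)⁻¹) {g f f' : H} (hf : A f = g) (hf' : A' f' = g) :
    ‖f - f'‖ ≤ 2 * ‖g‖ * ‖Ring.inverse A‖ ^ 2 * ‖A' - A‖ := by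
  rw [norm_sub_rev] at h
  set c := ‖Ring.inverse A‖
  set d := ‖A' - A‖
  have hc : 0 ≤ c := norm_nonneg _
  have hd : 0 ≤ d := norm_nonneg _
  -- Comparing with `f'` rather than `f` on the right involves only the inverse of `A`.
  have hdiff : f - f' = Ring.inverse A ((A' - A) f') := by
    refine (apply_eq_iff_eq_inverse_apply hA _ _).1 ?_
    rw [map_sub, hf, sub_apply, hf']
  have h1 : ‖f - f'‖ ≤ c * d * ‖f'‖ := by
    rw [hdiff, mul_assoc]
    exact (ContinuousLinearMap.le_opNorm _ _).trans
      (mul_le_mul_of_nonneg_left (ContinuousLinearMap.le_opNorm _ _) hc)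
  have h2 : ‖f‖ ≤ c * ‖g‖ := by
    rw [(apply_eq_iff_eq_inverse_apply hA _ _).1 hf]
    exact ContinuousLinearMap.le_opNorm _ _
  have hcd : c * d ≤ 1 / 2 := by
    rcases hc.eq_or_lt with h0 | hpos
    · rw [← h0]; norm_num
    · calc c * d ≤ c * (2 * c)⁻¹ := mul_le_mul_of_nonneg_left h hc
        _ = 1 / 2 := by field_simp
  have h3 : ‖f'‖ ≤ ‖f‖ + ‖f - f'‖ := by
    simpa [norm_sub_rev] using norm_sub_le f (f - f')
  have h4 : c * d * ‖f'‖ ≤ 1 / 2 * ‖f'‖ := mul_le_mul_of_nonneg_right hcd (norm_nonneg _)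
  calc ‖f - f'‖ ≤ c * d * ‖f'‖ := h1
    _ ≤ c * d * (2 * (c * ‖g‖)) :=
      -- Absorption: `‖f'‖ ≤ ‖f‖ + ‖f'‖ / 2` yields `‖f'‖ ≤ 2 * ‖f‖`, whence the factor 2.
      mul_le_mul_of_nonneg_left (by linarith) (mul_nonneg hc hd)
    _ = 2 * ‖g‖ * c ^ 2 * d := by ring

variable [CompleteSpace H]

theorem IsKClass.isUnit_and_inverse_mem_elemental {A : H →L[ℂ] H} (hA : IsKClass A) :
    IsUnit A ∧ Ring.inverse A ∈ Algebra.elemental ℂ A := by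
  obtain ⟨W, -, hsp, hc, h0, hcon⟩ := hA
  refine _root_.isUnit_and_inverse_mem_elemental A hcon.isPreconnected h0 (fun hb => ?_)
    (Set.compl_subset_compl.2 (hsp.trans subset_closure))
  -- The plane is the union of the compact `closure W` and its complement, so the latter is
  -- unbounded.
  refine NormedSpace.unbounded_univ ℂ ℂ ?_
  simpa using hb.union hc.isBounded

theorem IsKClass.isUnit {A : H →L[ℂ] H} (hA : IsKClass A) : IsUnit A :=
  hA.isUnit_and_inverse_mem_elemental.1

theorem IsKClass.exists_tendsto_aeval {A : H →L[ℂ] H} (hA : IsKClass A) :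
    ∃ p : ℕ → Polynomial ℂ,
      Tendsto (fun n => Polynomial.aeval A (p n)) atTop (𝓝 (Ring.inverse A)) :=
  exists_tendsto_aeval_of_mem_elemental hA.isUnit_and_inverse_mem_elemental.2

theorem IsKClass.krylovSolvable {A : H →L[ℂ] H} (hA : IsKClass A) (g : H) :
    KrylovSolvable A g := by
  obtain ⟨p, hp⟩ := hA.exists_tendsto_aeval
  exact krylovSolvable_of_tendsto_aeval hA.isUnit hp g

theorem isOpen_setOf_isKClass : IsOpen {B : H →L[ℂ] H | IsKClass B} := by
  -- Only the spectral inclusion involves the operator, so the same `W` serves all nearby ones.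
  refine isOpen_iff_mem_nhds.2 fun A ⟨W, hWo, hsp, hW⟩ => ?_
  filter_upwards [(upperHemicontinuous_spectrum ℂ (H →L[ℂ] H)).forall_isOpen A W hWo hsp]
    with B hB
  exact ⟨W, hWo, hB, hW⟩

theorem isUnit_of_norm_sub_le_inv_two_mul {A A' : H →L[ℂ] H} (hA : IsUnit A)
    (h : ‖A - A'‖ ≤ (2 * ‖Ring.inverse A‖)⁻¹) : IsUnit A' := by
  obtain ⟨u, rfl⟩ := hA
  rw [Ring.inverse_unit] at h
  rcases (norm_nonneg (↑u⁻¹ : H →L[ℂ] H)).eq_or_lt with h0 | hpos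
  -- If the inverse has norm zero, the convention `0⁻¹ = 0` makes the radius zero and forces `A' =
  -- A`.
  · rw [← h0, mul_zero, inv_zero] at h
    rw [← sub_eq_zero.1 (norm_le_zero_iff.1 h)]
    exact u.isUnit
  -- The factor 2 puts `A'` strictly inside the Neumann series radius `‖u⁻¹‖⁻¹`.
  · refine (Units.ofNearby u A' ?_).isUnit
    rw [norm_sub_rev]
    exact h.trans_lt (inv_strictAnti₀ hpos (by linarith))

end Operators

theorem theorem5p1 {H : Type*} [NormedAddCommGroup H] [InnerProductSpace ℂ H] [CompleteSpace H]
    (A : H →L[ℂ] H) (hA : IsKClass A) :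
    -- (i) `A` is invertible, its inverse is a norm limit of polynomials in `A`, and for every datum
    -- the problem is Krylov solvable, with unique solution `A⁻¹ g`
    (IsUnit A ∧
      (∃ p : ℕ → Polynomial ℂ,
        Filter.Tendsto (fun n => Polynomial.aeval A (p n)) Filter.atTop (nhds (Ring.inverse A))) ∧
      ∀ g : H, KrylovSolvable A g ∧ ∀ f : H, A f = g ↔ f = Ring.inverse A g) ∧
    -- (ii) the class is open, and all nearby operators give Krylov solvable problems
    (IsOpen {B : H →L[ℂ] H | IsKClass B} ∧
      ∃ ε : ℝ, 0 < ε ∧ ∀ A' : H →L[ℂ] H, ‖A' - A‖ < ε →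
        IsKClass A' ∧ IsUnit A' ∧
        ∀ g : H, KrylovSolvable A' g ∧ ∀ f' : H, A' f' = g ↔ f' = Ring.inverse A' g) ∧
    -- (iii) quantitative stability of the solution
    (∀ A' : H →L[ℂ] H, ‖A - A'‖ ≤ (2 * ‖Ring.inverse A‖)⁻¹ →
      IsUnit A' ∧
      ∀ g f f' : H, A f = g → A' f' = g →
        ‖f - f'‖ ≤ 2 * ‖g‖ * ‖Ring.inverse A‖ ^ 2 * ‖A' - A‖) := by

  refine ⟨⟨hA.isUnit, hA.exists_tendsto_aeval, fun g =>
    ⟨hA.krylovSolvable g, fun f => apply_eq_iff_eq_inverse_apply hA.isUnit f g⟩⟩,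
    ⟨isOpen_setOf_isKClass, ?_⟩, fun A' h => ⟨isUnit_of_norm_sub_le_inv_two_mul hA.isUnit h,
      fun g f f' hf hf' => norm_sub_le_of_norm_sub_le_inv_two_mul hA.isUnit h hf hf'⟩⟩
  obtain ⟨ε, hε, hball⟩ := Metric.isOpen_iff.1 isOpen_setOf_isKClass A hA
  refine ⟨ε, hε, fun A' h => ?_⟩
  have hA' : IsKClass A' := hball (mem_ball_iff_norm.2 h)
  exact ⟨hA', hA'.isUnit, fun g =>
    ⟨hA'.krylovSolvable g, fun f' => apply_eq_iff_eq_inverse_apply hA'.isUnit f' g⟩⟩
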